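/- **Setting.** Let $T$ be a finite tree with node set $V(T)$, let $V\subseteq V(T)$ be a nonempty set of nodes (the terminals), and let $K_V$ be the complete graph on $V$. Let $l\colon E(T)\to\mathbb{R}_+$ be edge-lengths, and let $a\colon E(K_V)\to\mathbb{R}_+$ be the tree metric represented by $T$ and $l$: for distinct $i,j\in V$, $a(ij)$ is the $l$-length of the unique path between $i$ and $j$ in $T$. Let $r\colon V\times V\to\mathbb{Z}_+$ be a symmetric connectivity requirement. For $X\subseteq V$ put $R(X)=\max\{r(i,j): i\in X,\ j\in V\setminus X\}$ (with $\max\emptyset=0$). For a set $X$ of nodes of a graph $G$, $\delta_G(X)$ is the set of edges of $G$ with exactly one end in $X$; write $\delta_G(v)=\delta_G(\{v\})$, and $f(S)=\sum_{x\in S}f(x)$ for a function $f$ and a finite set $S$. Fix $v\in V$; for $e\in E(T)$ let $X_e\subseteq V$ be the set of nodes of $V$ reachable from $v$ in $T$ without using $e$. An *integral realization* of $r$ is a function $y\colon E(K_V)\to\mathbb{Z}_+$ such that $y(\delta_{K_V}(X))\ge r(s,t)$ for all distinct $s,t\in V$ and all $X\subseteq V$ with $s\in X$, $t\notin X$. A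 capacity $c\colon E(T)\to\mathbb{Z}_+$ is *$r$-feasible* if $c(\delta_T(w))$ is even for all $w\in V(T)\setminus V$, and $c(e)\ge R(X_e)$ for all $e\in E(T)$. *Splitting off* two edges $su,sz$ (with $u,z\neq s$) of a multigraph at the node $s$ means replacing them by one new edge $uz$ (a loop if $u=z$). **Theorem.** Assume that $R(X_e)>1$ for all $e\in E(T)$. 1. Let $y$ be an integral realization of $r$, and define $c(e)=\sum\{y(ij) : ij\in E(K_V),\ |\{i,j\}\cap X_e|=1\}$ for $e\in E(T)$. Then $c$ is $r$-feasible and $\sum_{e\in E(T)}l(e)c(e)=\sum_{e\in E(K_V)}a(e)y(e)$. 2. For every $r$-feasible capacity $c\colon E(T)\to\mathbb{Z}_+$ there is an integral realization $y$ of $r$ with $\sum_{e\in E(K_V)}a(e)y(e)\le\sum_{e\in E(T)}l(e)c(e)$. Moreover, $y$ can be chosen so that it is obtained as follows: replace every edge $e$ of $T$ by $c(e)$ parallel edges, perform a finite sequence of splittings-off at nodes of $V(T)\setminus V$ after which no node of $V(T)\setminus V$ is incident to a non-loop edge, and let $y(ij)$ be the number of edges between $i$ and $j$ in the resulting multigraph.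 -/

import Mathlib

open scoped NNReal

namespace NetSynth

section Graph

variable {α : Type*}

open scoped Classical in
/-- The cut `δ_G(X)`: the edges of `G` joining a node of `X` to a node outside `X`. -/
noncomputable def cut (G : SimpleGraph α) [Fintype G.edgeSet] (X : Finset α) :
    Finset G.edgeSet :=
  {e | ∃ i ∈ X, ∃ j ∉ X, (e : Sym2 α) = s(i, j)}

/-- The edge set `E(K_V)` of the complete graph on `V` (unordered pairs of distinct nodes). -/
abbrev CompleteEdge (V : Type*) : Type _ := (⊤ : SimpleGraph V).edgeSet

variable {V : Type*} [Fintype V] [DecidableEq V]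

/-- `R(X) = max {r i j | i ∈ X, j ∉ X}`.  The maximum over the empty family is `0`. -/
def maxReq (r : V → V → ℕ) (X : Finset V) : ℕ :=
  (X ×ˢ Xᶜ).sup fun p => r p.1 p.2

/-- `y` is a realization of `r`: every cut separating `s` from `t` has `y`-capacity at least
`r s t`, for all distinct `s`, `t`. -/
def IsRealization (r : V → V → ℕ) (y : CompleteEdge V → ℝ≥0) : Prop :=
  ∀ s t : V, s ≠ t → ∀ X : Finset V, s ∈ X → t ∉ X →
    (r s t : ℝ≥0) ≤ ∑ e ∈ cut (⊤ : SimpleGraph V) X, y e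

/-- `y` is an integral realization of `r`: a realization with values in the nonnegative
integers. -/
def IsIntegralRealization (r : V → V → ℕ) (y : CompleteEdge V → ℕ) : Prop :=
  IsRealization r fun e => (y e : ℝ≥0)

end Graph

section Tree

variable {N : Type*} [Fintype N] [DecidableEq N]

open scoped Classical in
/-- The length, with respect to `l`, of a path in `T` (a path uses every edge at most once). -/
noncomputable def pathLength (T : SimpleGraph N) [DecidableRel T.Adj] (l : T.edgeSet → ℝ≥0)
    {i j : N} (p : T.Path i j) : ℝ≥0 :=
  ∑ e ∈ Finset.univ.filter fun e : T.edgeSet => (e : Sym2 N) ∈ (p : T.Walk i j).edges, l e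

/-- The edge-cost `a` on `K_V` is represented by the tree `T` on the node set `N ⊇ V` with
edge-lengths `l`: the cost `a(ij)` is the length of the (unique) path in `T` joining `i`
and `j`. -/
def IsRepresentedBy {V : Finset N} (a : CompleteEdge V → ℝ≥0)
    (T : SimpleGraph N) [DecidableRel T.Adj] (l : T.edgeSet → ℝ≥0) : Prop :=
  T.IsTree ∧ ∀ (i j : V) (h : i ≠ j) (p : T.Path (i : N) (j : N)),
    a ⟨s(i, j), h⟩ = pathLength T l p

open scoped Classical in
/-- `X_e`: the nodes of `V` that can be reached from `v` in `T` without using the edge `e`. -/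
noncomputable def side {V : Finset N} (T : SimpleGraph N) (v : V) (e : T.edgeSet) : Finset V :=
  {u | (T.deleteEdges {(e : Sym2 N)}).Reachable (v : N) (u : N)}

/-- The edge-capacity on `T` obtained from `y`: `c(e)` is the total `y`-capacity of the pairs
`ij` with exactly one of `i`, `j` in `X_e`. -/
noncomputable def treeCapacity {V : Finset N} (T : SimpleGraph N) (v : V)
    (y : CompleteEdge V → ℕ) (e : T.edgeSet) : ℕ :=
  ∑ f ∈ cut (⊤ : SimpleGraph V) (side T v e), y f

/-- `r`-feasibility of an integer edge-capacity `c` on `T`. -/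
structure IsFeasible {V : Finset N} (r : V → V → ℕ) (T : SimpleGraph N) [DecidableRel T.Adj]
    (v : V) (c : T.edgeSet → ℕ) : Prop where
  even_degree : ∀ w : N, w ∉ V → Even (∑ e ∈ cut T {w}, c e)
  req_le : ∀ e : T.edgeSet, maxReq r (side T v e) ≤ c e

end Tree

section Splitting

variable {N : Type*} [DecidableEq N]

/-- Multigraphs on `N` are given by edge multiplicities `m : Sym2 N → ℕ`; loops are allowed.
`SplitOff s m m'` says that `m'` arises from `m` by splitting off a pair of edges `su`, `sz`:
the two edges are replaced by one new edge `uz` (a loop if `u = z`). -/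
def SplitOff (s : N) (m m' : Sym2 N → ℕ) : Prop :=
  ∃ u z : N, u ≠ s ∧ z ≠ s ∧
    m' + Pi.single s(s, u) 1 + Pi.single s(s, z) 1 = m + Pi.single s(u, z) 1

/-- `m'` arises from `m` by finitely many splittings-off, each at a node outside `V`. -/
def SplitsTo (V : Finset N) : (Sym2 N → ℕ) → (Sym2 N → ℕ) → Prop :=
  Relation.ReflTransGen fun m m' => ∃ s : N, s ∉ V ∧ SplitOff s m m'

/-- The multigraph obtained from `T` by replacing every edge `e` by `c e` parallel edges. -/
def treeMultigraph (T : SimpleGraph N) [DecidableRel T.Adj] (c : T.edgeSet → ℕ) :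
    Sym2 N → ℕ :=
  fun e => if h : e ∈ T.edgeSet then c ⟨e, h⟩ else 0

/-- `y` is obtained from `c` by repeated splitting-off at the nodes outside `V`: the splitting-off
ends in a multigraph in which every node outside `V` has degree `0` (not counting loops), and
`y(ij)` is the number of edges between `i` and `j` in it. -/
def IsObtainedBySplitting {V : Finset N} (T : SimpleGraph N) [DecidableRel T.Adj]
    (c : T.edgeSet → ℕ) (y : CompleteEdge V → ℕ) : Prop :=
  ∃ m : Sym2 N → ℕ, SplitsTo V (treeMultigraph T c) m ∧
    (∀ s u : N, s ∉ V → u ≠ s → m s(s, u) = 0) ∧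
    ∀ e : CompleteEdge V, y e = m ((e : Sym2 V).map Subtype.val)

end Splitting

end NetSynth

open NetSynth

/-! For part 1, send `y(ij)` units along the tree path from `i` to `j`; then `c(e)` is the load of
`e`. A path with both ends in `V` uses an even number of edges at any other node, the load of `e` is
the `y`-cut of `X_e`, and double counting gives the cost identity (`isFeasible_treeCapacity`,
`sum_length_mul_treeCapacity`).

For part 2, regard `c` as edge multiplicities on `T`. A set separating terminals `i` and `j` cuts
some edge `e` of their tree path, and `c(e) ≥ R(X_e) ≥ max (r i j) 2`. Hence the requirement `q =
max r 2` holds between terminals. A cut separating two terminals has at least two edges, and any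
other cut is even because nonterminals have even degree; so no cut has weight one. This is the
hypothesis of Mader's theorem (`exists_splitting_pair`), which supplies a pair of edges at a
nonterminal that can be split off without violating `q`. Parity persists and the number of edges
drops, so the process ends with all nonterminals isolated. Splitting never increases a cut, so the
load of `e` under the final `y` is at most `c(e)`, and the identity of part 1 bounds the cost.

For Mader's theorem let `d` be the cut weight and `R` the requirement of a set avoiding `s`, with `d
≥ R`. Call such a set tight if `d ≤ R` and dangerous if `d ≤ R + 1`; a pair of edges is bad exactly
when a dangerous set contains both its ends other than `s`. Submodularity and posimodularity of `d`
are played against skew-supermodularity of `R`. Tight sets with several nodes are contracted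
(induction on the number of nodes); when none is left, three maximal dangerous sets through one
neighbor of `s` produce a cut of weight one (`exists_splitting_pair_of_tight_singletons`). -/

namespace NetSynth

/-! ### Cut weights: submodularity, posimodularity, parity -/

section CutValue

variable {N : Type*}

/-- The total weight of the edges between `A` and `B`. -/
def weightBetween (w : N → N → ℕ) (A B : Finset N) : ℕ := ∑ x ∈ A, ∑ y ∈ B, w x y

theorem weightBetween_mono (w : N → N → ℕ) {A A' B B' : Finset N} (hA : A ⊆ A') (hB : B ⊆ B') :
    weightBetween w A B ≤ weightBetween w A' B' :=
  (Finset.sum_le_sum fun _ _ => Finset.sum_le_sum_of_subset hB).trans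
    (Finset.sum_le_sum_of_subset hA)

theorem weightBetween_comm {w : N → N → ℕ} (hw : ∀ x y, w x y = w y x) (A B : Finset N) :
    weightBetween w A B = weightBetween w B A := by
  unfold weightBetween
  rw [Finset.sum_comm]
  exact Finset.sum_congr rfl fun _ _ => Finset.sum_congr rfl fun _ _ => hw _ _

theorem weightBetween_union_right [DecidableEq N] (w : N → N → ℕ) (A : Finset N) {B C : Finset N}
    (h : Disjoint B C) :
    weightBetween w A (B ∪ C) = weightBetween w A B + weightBetween w A C := by
  unfold weightBetween
  rw [← Finset.sum_add_distrib]
  exact Finset.sum_congr rfl fun _ _ => Finset.sum_union h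

theorem weightBetween_singleton (w : N → N → ℕ) (x y : N) :
    weightBetween w {x} {y} = w x y := by
  simp [weightBetween]

theorem le_weightBetween (w : N → N → ℕ) {A B : Finset N} {x y : N} (hx : x ∈ A) (hy : y ∈ B) :
    w x y ≤ weightBetween w A B := by
  rw [← weightBetween_singleton w x y]
  exact weightBetween_mono w (Finset.singleton_subset_iff.2 hx) (Finset.singleton_subset_iff.2 hy)

variable [Fintype N] [DecidableEq N]

theorem weightBetween_eq_ite (w : N → N → ℕ) (A B : Finset N) :
    weightBetween w A B = ∑ x, ∑ y, if x ∈ A ∧ y ∈ B then w x y else 0 := by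
  simp [weightBetween, ite_and, Finset.sum_ite_mem]

/-- The weight of the cut defined by `X`. -/
def cutValue (w : N → N → ℕ) (X : Finset N) : ℕ := weightBetween w X Xᶜ

theorem cutValue_compl {w : N → N → ℕ} (hw : ∀ x y, w x y = w y x) (X : Finset N) :
    cutValue w Xᶜ = cutValue w X := by
  rw [cutValue, compl_compl, weightBetween_comm hw, cutValue]

theorem cutValue_submodular {w : N → N → ℕ} (hw : ∀ x y, w x y = w y x) (X Y : Finset N) :
    cutValue w X + cutValue w Y =
      cutValue w (X ∩ Y) + cutValue w (X ∪ Y) + 2 * weightBetween w (X \ Y) (Y \ X) := by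
  rw [two_mul]
  -- Reversing one copy of the cross term makes the identity hold for each ordered pair separately.
  nth_rewrite 2 [weightBetween_comm hw]
  simp only [cutValue, weightBetween_eq_ite, ← Finset.sum_add_distrib]
  refine Finset.sum_congr rfl fun x _ => Finset.sum_congr rfl fun y _ => ?_
  by_cases h1 : x ∈ X <;> by_cases h2 : x ∈ Y <;> by_cases h3 : y ∈ X <;>
    by_cases h4 : y ∈ Y <;> simp [h1, h2, h3, h4]

theorem cutValue_posimodular {w : N → N → ℕ} (hw : ∀ x y, w x y = w y x) (X Y : Finset N) :
    cutValue w X + cutValue w Y =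
      cutValue w (X \ Y) + cutValue w (Y \ X) + 2 * weightBetween w (X ∩ Y) (X ∪ Y)ᶜ := by
  have h := cutValue_submodular hw X Yᶜ
  have h1 : X ∩ Yᶜ = X \ Y := by ext; simp
  have h2 : X ∪ Yᶜ = (Y \ X)ᶜ := by ext; simp; tauto
  have h3 : X \ Yᶜ = X ∩ Y := by ext; simp
  have h4 : Yᶜ \ X = (X ∪ Y)ᶜ := by ext; simp; tauto
  rwa [h1, h2, h3, h4, cutValue_compl hw, cutValue_compl hw] at h

/-- A set of nodes of even degree defines an even cut. -/
theorem even_cutValue {w : N → N → ℕ} (hw : ∀ x y, w x y = w y x) (A : Finset N)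
    (hA : ∀ a ∈ A, Even (cutValue w {a})) : Even (cutValue w A) := by
  induction A using Finset.induction_on with
  | empty => simp [cutValue, weightBetween]
  | insert a A ha ih =>
    have h := cutValue_submodular hw {a} A
    have h0 : ({a} : Finset N) ∩ A = ∅ := Finset.singleton_inter_of_notMem ha
    have h1 : cutValue w (∅ : Finset N) = 0 := by simp [cutValue, weightBetween]
    rw [h0, h1, ← Finset.insert_eq] at h
    have h2 := hA a (by simp)
    have h3 := ih fun b hb => hA b (by simp [hb])
    rw [Nat.even_iff] at *
    omega

end CutValue

/-! ### Requirements of sets and local edge-connectivity -/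

section Requirement

variable {N : Type*} [Fintype N] [DecidableEq N]

/-- The largest requirement between a node of `X` and a node outside `X` other than `s`. -/
def reqMax (s : N) (r : N → N → ℕ) (X : Finset N) : ℕ :=
  (X ×ˢ (insert s X)ᶜ).sup fun p => r p.1 p.2

theorem le_reqMax {s : N} (r : N → N → ℕ) {X : Finset N} {x y : N} (hx : x ∈ X) (hy : y ∉ X)
    (hys : y ≠ s) : r x y ≤ reqMax s r X :=
  Finset.le_sup (f := fun p : N × N => r p.1 p.2) (b := (x, y)) (by simp [hx, hy, hys])

theorem reqMax_le {s : N} {r : N → N → ℕ} {X : Finset N} {k : ℕ}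
    (h : ∀ x ∈ X, ∀ y, y ∉ X → y ≠ s → r x y ≤ k) : reqMax s r X ≤ k := by
  refine Finset.sup_le fun p hp => ?_
  simp only [Finset.mem_product, Finset.mem_compl, Finset.mem_insert, not_or] at hp
  exact h _ hp.1 _ hp.2.2 hp.2.1

theorem exists_reqMax_eq {s : N} (r : N → N → ℕ) {X : Finset N} (hX : X.Nonempty)
    (hs : s ∉ X) (hX' : X ≠ {s}ᶜ) :
    ∃ x ∈ X, ∃ y, y ∉ X ∧ y ≠ s ∧ reqMax s r X = r x y := by
  have hne : (X ×ˢ (insert s X)ᶜ).Nonempty := by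
    refine Finset.Nonempty.product hX ?_
    by_contra h
    rw [Finset.not_nonempty_iff_eq_empty, Finset.compl_eq_empty_iff] at h
    apply hX'
    ext z
    have hz : z ∈ insert s X := h ▸ Finset.mem_univ z
    simp only [Finset.mem_insert] at hz
    simp only [Finset.mem_compl, Finset.mem_singleton]
    exact ⟨fun h h' => hs (h' ▸ h), fun h => hz.resolve_left h⟩
  obtain ⟨p, hp, h⟩ := Finset.exists_mem_eq_sup _ hne fun p : N × N => r p.1 p.2
  simp only [Finset.mem_product, Finset.mem_compl, Finset.mem_insert, not_or] at hp
  exact ⟨p.1, hp.1, p.2, hp.2.2, hp.2.1, h⟩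

theorem reqMax_compl_singleton (s : N) (r : N → N → ℕ) : reqMax s r {s}ᶜ = 0 := by
  refine Nat.le_zero.1 (reqMax_le fun x _ y hy hys => ?_)
  simp [hys] at hy

theorem reqMax_le_reqMax_compl {s : N} {r : N → N → ℕ} (hr : ∀ x y, r x y = r y x)
    {X : Finset N} (hs : s ∉ X) : reqMax s r X ≤ reqMax s r (insert s X)ᶜ := by
  refine reqMax_le fun x hx y hy hys => ?_
  rw [hr]
  exact le_reqMax r (by simp [hy, hys]) (by simp [hx]) (fun h => hs (h ▸ hx))

/-- The requirement function is skew-supermodular. -/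
theorem reqMax_skew {s : N} {r : N → N → ℕ} (hr : ∀ x y, r x y = r y x) {X Y : Finset N}
    (hsX : s ∉ X) (hsY : s ∉ Y) (hX : X.Nonempty) (hY : Y.Nonempty)
    (hX' : X ≠ {s}ᶜ) (hY' : Y ≠ {s}ᶜ) :
    reqMax s r X + reqMax s r Y ≤ reqMax s r (X ∩ Y) + reqMax s r (X ∪ Y) ∨
      reqMax s r X + reqMax s r Y ≤ reqMax s r (X \ Y) + reqMax s r (Y \ X) := by
  obtain ⟨x, hx, x', hx', hxs', hRX⟩ := exists_reqMax_eq r hX hsX hX'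
  obtain ⟨y, hy, y', hy', hys', hRY⟩ := exists_reqMax_eq r hY hsY hY'
  have hxs : x ≠ s := fun h => hsX (h ▸ hx)
  have hys : y ≠ s := fun h => hsY (h ▸ hy)
  have key : ∀ {p q : N}, p ≠ s → q ≠ s → ∀ Z : Finset N,
      (p ∈ Z ∧ q ∉ Z) ∨ (q ∈ Z ∧ p ∉ Z) → r p q ≤ reqMax s r Z := by
    intro p q hp hq Z h
    rcases h with h | h
    · exact le_reqMax r h.1 h.2 hq
    · rw [hr]; exact le_reqMax r h.1 h.2 hp
  have a1 := key hxs hxs' (X ∩ Y)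
  have a2 := key hxs hxs' (X ∪ Y)
  have a3 := key hxs hxs' (X \ Y)
  have a4 := key hxs hxs' (Y \ X)
  have b1 := key hys hys' (X ∩ Y)
  have b2 := key hys hys' (X ∪ Y)
  have b3 := key hys hys' (X \ Y)
  have b4 := key hys hys' (Y \ X)
  rw [hRX, hRY]
  -- If one maximizing pair is separated by both `X ∩ Y` and `X ∪ Y` and the other only by the two
  -- differences, the larger of the two maxima counted twice suffices. In all other positions the
  -- pairs can be assigned to the two different sets of one alternative.
  by_cases h1 : x ∈ Y <;> by_cases h2 : x' ∈ Y <;> by_cases h3 : y ∈ X <;>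
    by_cases h4 : y' ∈ X <;>
    simp [h1, h2, h3, h4, hx, hx', hy, hy'] at a1 a2 a3 a4 b1 b2 b3 b4 <;> omega

/-- The local edge-connectivity: the least weight of a cut separating `x` from `y`. -/
noncomputable def localConn (w : N → N → ℕ) (x y : N) : ℕ :=
  sInf {k | ∃ X : Finset N, x ∈ X ∧ y ∉ X ∧ cutValue w X = k}

theorem localConn_le (w : N → N → ℕ) {x y : N} {X : Finset N} (hx : x ∈ X) (hy : y ∉ X) :
    localConn w x y ≤ cutValue w X :=
  Nat.sInf_le ⟨X, hx, hy, rfl⟩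

theorem exists_localConn_eq (w : N → N → ℕ) {x y : N} (h : x ≠ y) :
    ∃ X : Finset N, x ∈ X ∧ y ∉ X ∧ cutValue w X = localConn w x y :=
  Nat.sInf_mem (s := {k | ∃ X : Finset N, x ∈ X ∧ y ∉ X ∧ cutValue w X = k})
    ⟨_, {x}, by simp, by simpa using h.symm, rfl⟩

theorem localConn_comm {w : N → N → ℕ} (hw : ∀ x y, w x y = w y x) (x y : N) :
    localConn w x y = localConn w y x := by
  have h : ∀ x y, x ≠ y → localConn w x y ≤ localConn w y x := by
    intro x y hxy
    obtain ⟨X, hX, hX', h⟩ := exists_localConn_eq w hxy.symm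
    rw [← h, ← cutValue_compl hw]
    exact localConn_le w (by simpa using hX') (by simpa using hX)
  rcases eq_or_ne x y with rfl | hxy
  · rfl
  · exact le_antisymm (h x y hxy) (h y x hxy.symm)

theorem reqMax_localConn_le (w : N → N → ℕ) (s : N) (X : Finset N) :
    reqMax s (localConn w) X ≤ cutValue w X :=
  reqMax_le fun _ hx _ hy _ => localConn_le w hx hy

end Requirement

/-! ### Mader's theorem when every tight set has at most one node -/

section SplittingPair

variable {N : Type*} [Fintype N] [DecidableEq N]

/-- The cut of a set `X` with at most one unit of surplus contains at most half of the edges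
at `s`. -/
theorem two_mul_weightBetween_le {w : N → N → ℕ} (hw : ∀ x y, w x y = w y x) {s : N}
    (heven : Even (cutValue w {s})) {X : Finset N} (hs : s ∉ X)
    (hX : cutValue w X ≤ reqMax s (localConn w) X + 1) :
    2 * weightBetween w {s} X ≤ cutValue w {s} := by
  have h := cutValue_submodular hw {s} X
  have h0 : ({s} : Finset N) ∩ X = ∅ := Finset.singleton_inter_of_notMem hs
  have h1 : cutValue w (∅ : Finset N) = 0 := by simp [cutValue, weightBetween]
  rw [h0, h1, ← Finset.insert_eq, Finset.sdiff_singleton_eq_erase, Finset.erase_eq_of_notMem hs,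
    Finset.sdiff_eq_self_of_disjoint (Finset.disjoint_singleton_left.2 hs)] at h
  have h2 := reqMax_le_reqMax_compl (localConn_comm hw) hs
  have h3 := reqMax_localConn_le w s (insert s X)ᶜ
  rw [cutValue_compl hw] at h3
  -- The inequalities give only `d(s) + 1` as upper bound; parity of `d(s)` removes the extra unit.
  rw [Nat.even_iff] at heven
  omega

theorem exists_neighbor_notMem {w : N → N → ℕ} {s : N} {Z : Finset N}
    (h : weightBetween w {s} Z < cutValue w {s}) : ∃ v, v ∉ Z ∧ v ≠ s ∧ 0 < w s v := by
  by_contra! hno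
  refine h.not_ge ?_
  simp only [cutValue, weightBetween, Finset.sum_singleton]
  refine Finset.sum_le_sum_of_ne_zero fun v hv hne => ?_
  by_contra hvZ
  exact hne (Nat.le_zero.1 (hno v hvZ (by simpa using hv)))

/-- If every pair containing the edge to a neighbor `t` of least degree is bad, three maximal
dangerous sets through `t` arise. Uncrossing makes them a common set `A` plus one further node each,
with a single edge leaving `A`, namely the one to `s`; this contradicts `hone`. -/
theorem exists_splitting_pair_of_tight_singletons {w : N → N → ℕ} (hw : ∀ x y, w x y = w y x)
    {s : N} (heven : Even (cutValue w {s})) (hpos : 0 < cutValue w {s})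
    (hone : ∀ A, cutValue w A ≠ 1)
    (htight : ∀ T : Finset N, s ∉ T → cutValue w T ≤ reqMax s (localConn w) T → T.card ≤ 1) :
    ∃ u v, u ≠ s ∧ v ≠ s ∧ 0 < w s u ∧ 0 < w s v ∧ (u = v → 2 ≤ w s u) ∧
      ∀ X : Finset N, s ∉ X → u ∈ X → v ∈ X →
        reqMax s (localConn w) X + 2 ≤ cutValue w X := by
  set R := reqMax s (localConn w) with hR
  have hsym := localConn_comm hw
  have htwo : 2 ≤ cutValue w {s} := by rw [Nat.even_iff] at heven; omega
  obtain ⟨t, ht, htmin⟩ := Finset.exists_min_image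
    (Finset.univ.filter fun v => v ≠ s ∧ 0 < w s v) (fun v => cutValue w {v}) (by
      obtain ⟨v, -, hv⟩ := exists_neighbor_notMem (w := w) (s := s) (Z := ∅)
        (by simpa [weightBetween] using hpos)
      exact ⟨v, by simpa using hv⟩)
  simp only [Finset.mem_filter, Finset.mem_univ, true_and] at ht htmin
  obtain ⟨hts, htw⟩ := ht
  by_contra! hno
  have hdang : ∀ v, v ≠ s → 0 < w s v → (t = v → 2 ≤ w s t) →
      ∃ X : Finset N, s ∉ X ∧ t ∈ X ∧ v ∈ X ∧ cutValue w X ≤ R X + 1 := by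
    intro v hv hvw htv
    obtain ⟨X, h1, h2, h3, h4⟩ := hno t v hts hv htw hvw htv
    exact ⟨X, h1, h2, h3, by omega⟩
  set D : Set (Finset N) := {X | s ∉ X ∧ cutValue w X ≤ R X + 1} with hD
  have hmax : ∀ v, v ≠ s → v ≠ t → 0 < w s v → ∃ X, t ∈ X ∧ v ∈ X ∧ Maximal (· ∈ D) X := by
    intro v hv hvt hvw
    obtain ⟨X, h1, h2, h3, h4⟩ := hdang v hv hvw fun h => absurd h.symm hvt
    obtain ⟨M, hXM, hM⟩ := D.toFinite.exists_le_maximal (show X ∈ D from ⟨h1, h4⟩)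
    exact ⟨M, hXM h2, hXM h3, hM⟩
  -- every dangerous set containing `t` and a further neighbor keeps its requirement without `t`
  have herase : ∀ X ∈ D, t ∈ X → (∃ u ∈ X, u ≠ t ∧ 0 < w s u) → R X ≤ R (X.erase t) := by
    rintro X ⟨hsX, -⟩ htX ⟨u, huX, hut, huw⟩
    have hus : u ≠ s := fun h => hsX (h ▸ huX)
    refine reqMax_le fun x hx y hy hys => ?_
    by_cases hxt : x = t
    · subst hxt
      have h1 : localConn w x y ≤ cutValue w {x} :=
        localConn_le w (by simp) (by simpa using fun h : y = x => hy (h ▸ hx))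
      -- A minimum cut between `u` and `t`, taken on the side avoiding `s`, is tight, hence is `{u}`
      -- or `{t}`; by the choice of `t` its weight is at least the degree of `t`.
      have h2 : cutValue w {x} ≤ localConn w u x := by
        have key : ∀ p q : N, p ≠ q → p ≠ s → q ≠ s → ∀ W : Finset N, s ∉ W → p ∈ W → q ∉ W →
            cutValue w W = localConn w p q → cutValue w {p} = localConn w p q := by
          intro p q _ _ hqs W hsW hpW hqW hW
          have hc := htight W hsW (hW ▸ le_reqMax _ hpW hqW hqs)
          rwa [Finset.eq_singleton_iff_unique_mem.2
            ⟨hpW, fun z hz => Finset.card_le_one.1 hc z hz p hpW⟩] at hW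
        obtain ⟨W, huW, hxW, hW⟩ := exists_localConn_eq w hut
        by_cases hsW : s ∈ W
        · refine le_of_eq ?_
          rw [hsym u x]
          refine key x u hut.symm hts hus Wᶜ (by simpa using hsW) (by simpa using hxW)
            (by simpa using huW) ?_
          rw [cutValue_compl hw, hW, hsym]
        · rw [← key u x hut hus hts W hsW huW hxW hW]
          exact htmin u ⟨hus, huw⟩
      exact h1.trans (h2.trans (le_reqMax _ (by simp [hut, huX]) (by simp) hts))
    · exact le_reqMax _ (by simp [hxt, hx]) (by simp [hy]) hys
  have hpair : ∀ X Y, Maximal (· ∈ D) X → Maximal (· ∈ D) Y → t ∈ X → t ∈ Y →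
      (∃ u ∈ X, u ≠ t ∧ 0 < w s u) → (∃ u ∈ Y, u ≠ t ∧ 0 < w s u) → X ≠ Y →
      (X \ Y).card ≤ 1 ∧ weightBetween w (X ∩ Y) (X ∪ Y)ᶜ = 1 := by
    intro X Y hX hY htX htY huX huY hne
    have hsX := hX.prop.1
    have hsY := hY.prop.1
    have dX := hX.prop.2
    have dY := hY.prop.2
    have hcompl : ∀ Z ∈ D, Z ≠ {s}ᶜ := by
      rintro Z ⟨-, hZ⟩ rfl
      rw [hR, reqMax_compl_singleton, cutValue_compl hw] at hZ
      omega
    have hun : R (X ∪ Y) + 2 ≤ cutValue w (X ∪ Y) := by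
      by_contra hlt
      have hmem : X ∪ Y ∈ D := ⟨by simp [hsX, hsY], by omega⟩
      exact hne ((hX.eq_of_le hmem Finset.subset_union_left).trans
        (hY.eq_of_le hmem Finset.subset_union_right).symm)
    have hsub := cutValue_submodular hw X Y
    have hpos := cutValue_posimodular hw X Y
    -- In the other alternative `X ∩ Y` is tight because `X ∪ Y` is not dangerous, so it is `{t}`,
    -- and `herase` yields the same inequality. Posimodularity then holds with no slack beyond the
    -- edge `ts`.
    have hb : R X + R Y ≤ R (X \ Y) + R (Y \ X) := by
      have hskew := reqMax_skew hsym hsX hsY ⟨t, htX⟩ ⟨t, htY⟩ (hcompl X hX.prop)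
        (hcompl Y hY.prop)
      rw [← hR] at hskew
      rcases hskew with h | h
      · have hint : R (X ∩ Y) ≤ _ := reqMax_localConn_le w s (X ∩ Y)
        have hc := htight (X ∩ Y) (by simp [hsX]) (show _ ≤ R (X ∩ Y) by omega)
        have hXY : X ∩ Y = {t} := by
          refine Finset.eq_singleton_iff_unique_mem.2 ⟨by simp [htX, htY], fun z hz => ?_⟩
          exact Finset.card_le_one.1 hc z hz t (by simp [htX, htY])
        have e1 : X \ Y = X.erase t := by
          rw [← Finset.sdiff_inter_self_left, hXY, Finset.sdiff_singleton_eq_erase]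
        have e2 : Y \ X = Y.erase t := by
          rw [← Finset.sdiff_inter_self_left, Finset.inter_comm, hXY,
            Finset.sdiff_singleton_eq_erase]
        rw [e1, e2]
        exact Nat.add_le_add (herase X hX.prop htX huX) (herase Y hY.prop htY huY)
      · exact h
    have h1 : R (X \ Y) ≤ _ := reqMax_localConn_le w s (X \ Y)
    have h2 : R (Y \ X) ≤ _ := reqMax_localConn_le w s (Y \ X)
    have h3 : w t s ≤ weightBetween w (X ∩ Y) (X ∪ Y)ᶜ :=
      le_weightBetween w (by simp [htX, htY]) (by simp [hsX, hsY])
    rw [hw] at h3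
    exact ⟨htight _ (by simp [hsX]) (show _ ≤ R (X \ Y) by omega), by omega⟩
  -- If the edge to `t` is multiple, a dangerous set for the pair `t`, `t` misses half of the edges
  -- at `s`; otherwise `t` accounts for only one of at least two edges.
  obtain ⟨v₁, hv₁s, hv₁t, hv₁w⟩ : ∃ v, v ≠ s ∧ v ≠ t ∧ 0 < w s v := by
    by_cases h2 : 2 ≤ w s t
    · obtain ⟨X, hsX, htX, -, hX⟩ := hdang t hts htw fun _ => h2
      have := two_mul_weightBetween_le hw heven hsX hX
      obtain ⟨v, hvX, hvs, hvw⟩ := exists_neighbor_notMem (w := w) (s := s) (Z := X) (by omega)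
      exact ⟨v, hvs, fun h => hvX (h ▸ htX), hvw⟩
    · obtain ⟨v, hv, hvs, hvw⟩ := exists_neighbor_notMem (w := w) (s := s) (Z := {t})
        (by rw [weightBetween_singleton]; omega)
      exact ⟨v, hvs, by simpa using hv, hvw⟩
  obtain ⟨X, htX, hv₁X, hX⟩ := hmax v₁ hv₁s hv₁t hv₁w
  have hhX := two_mul_weightBetween_le hw heven hX.prop.1 hX.prop.2
  obtain ⟨v₂, hv₂X, hv₂s, hv₂w⟩ := exists_neighbor_notMem (w := w) (s := s) (Z := X) (by omega)
  have hv₂t : v₂ ≠ t := fun h => hv₂X (h ▸ htX)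
  obtain ⟨Y, htY, hv₂Y, hY⟩ := hmax v₂ hv₂s hv₂t hv₂w
  have hhY := two_mul_weightBetween_le hw heven hY.prop.1 hY.prop.2
  -- `X` and `Y` each receive at most half of the edges at `s` and share the edge to `t`, so
  -- together they miss one.
  obtain ⟨v₃, hv₃, hv₃s, hv₃w⟩ : ∃ v, v ∉ X ∪ Y ∧ v ≠ s ∧ 0 < w s v := by
    refine exists_neighbor_notMem ?_
    have h1 : weightBetween w {s} X =
        weightBetween w {s} (X \ Y) + weightBetween w {s} (X ∩ Y) := by
      rw [← weightBetween_union_right _ _ (Finset.disjoint_sdiff_inter X Y),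
        Finset.sdiff_union_inter]
    have h2 : weightBetween w {s} (X ∪ Y) =
        weightBetween w {s} (X \ Y) + weightBetween w {s} Y := by
      rw [← weightBetween_union_right _ _ Finset.sdiff_disjoint, Finset.sdiff_union_self_eq_union]
    have h3 : w s t ≤ weightBetween w {s} (X ∩ Y) :=
      le_weightBetween w (by simp) (by simp [htX, htY])
    omega
  have hv₃X : v₃ ∉ X := fun h => hv₃ (Finset.mem_union_left _ h)
  have hv₃Y : v₃ ∉ Y := fun h => hv₃ (Finset.mem_union_right _ h)
  obtain ⟨Z, htZ, hv₃Z, hZ⟩ := hmax v₃ hv₃s (fun h => hv₃X (h ▸ htX)) hv₃w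
  have eX : ∃ u ∈ X, u ≠ t ∧ 0 < w s u := ⟨v₁, hv₁X, hv₁t, hv₁w⟩
  have eY : ∃ u ∈ Y, u ≠ t ∧ 0 < w s u := ⟨v₂, hv₂Y, hv₂t, hv₂w⟩
  have eZ : ∃ u ∈ Z, u ≠ t ∧ 0 < w s u := ⟨v₃, hv₃Z, fun h => hv₃X (h ▸ htX), hv₃w⟩
  have nXY : X ≠ Y := fun h => hv₂X (h ▸ hv₂Y)
  have nXZ : X ≠ Z := fun h => hv₃X (h ▸ hv₃Z)
  have nYZ : Y ≠ Z := fun h => hv₃Y (h ▸ hv₃Z)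
  obtain ⟨cXY, bXY⟩ := hpair X Y hX hY htX htY eX eY nXY
  obtain ⟨cYX, -⟩ := hpair Y X hY hX htY htX eY eX nXY.symm
  obtain ⟨cXZ, bXZ⟩ := hpair X Z hX hZ htX htZ eX eZ nXZ
  obtain ⟨cYZ, bYZ⟩ := hpair Y Z hY hZ htY htZ eY eZ nYZ
  obtain ⟨cZX, -⟩ := hpair Z X hZ hX htZ htX eZ eX nXZ.symm
  obtain ⟨cZY, -⟩ := hpair Z Y hZ hY htZ htY eZ eY nYZ.symm
  -- `X`, `Y`, `Z` consist of `X ∩ Y` and one further node each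
  have hZA : ∀ z ∈ Z, z ∈ X → z ∈ Y := by
    intro z hzZ hzX
    by_contra hzY
    have := Finset.card_le_one.1 cZY z (by simp [hzZ, hzY]) v₃ (by simp [hv₃Z, hv₃Y])
    exact hv₃X (this ▸ hzX)
  have hZA' : ∀ z ∈ Z, z ∈ Y → z ∈ X := by
    intro z hzZ hzY
    by_contra hzX
    have := Finset.card_le_one.1 cZX z (by simp [hzZ, hzX]) v₃ (by simp [hv₃Z, hv₃X])
    exact hv₃Y (this ▸ hzY)
  have hXne : ∃ x ∈ X, x ∉ Y := by
    by_contra! h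
    exact nXY (hX.eq_of_le hY.prop h)
  obtain ⟨x, hxX, hxY⟩ := hXne
  have hxZ : x ∉ Z := fun h => hxY (hZA x h hxX)
  have hv₂Z : v₂ ∉ Z := fun h => hv₂X (hZA' v₂ h hv₂Y)
  have hAZ : ∀ z ∈ X, z ∈ Y → z ∈ Z := by
    intro z hzX hzY
    by_contra hzZ
    have := Finset.card_le_one.1 cXZ z (by simp [hzX, hzZ]) x (by simp [hxX, hxZ])
    exact hxY (this ▸ hzY)
  have iXZ : X ∩ Z = X ∩ Y := by
    ext z; simp only [Finset.mem_inter]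
    exact ⟨fun h => ⟨h.1, hZA z h.2 h.1⟩, fun h => ⟨h.1, hAZ z h.1 h.2⟩⟩
  have iYZ : Y ∩ Z = X ∩ Y := by
    ext z; simp only [Finset.mem_inter]
    exact ⟨fun h => ⟨hZA' z h.2 h.1, h.1⟩, fun h => ⟨h.2, hAZ z h.1 h.2⟩⟩
  rw [iXZ] at bXZ
  rw [iYZ] at bYZ
  have hsX := hX.prop.1
  have hsY := hY.prop.1
  have hsZ := hZ.prop.1
  have hAs : 1 ≤ weightBetween w (X ∩ Y) {s} :=
    (hw s t ▸ htw : 0 < w t s).trans_le (le_weightBetween w (by simp [htX, htY]) (by simp))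
  -- The only unit of weight from `X ∩ Y` to `B` is taken by the edge to `s`.
  have hzero : ∀ p B, p ∈ B → s ∈ B → p ≠ s → weightBetween w (X ∩ Y) B = 1 →
      weightBetween w (X ∩ Y) {p} = 0 := by
    intro p B hp hs hps hB
    have h1 := weightBetween_union_right w (X ∩ Y) (Finset.disjoint_singleton.2 hps)
    have h2 : weightBetween w (X ∩ Y) ({p} ∪ {s}) ≤ weightBetween w (X ∩ Y) B :=
      weightBetween_mono w subset_rfl (by
        intro z hz
        rcases Finset.mem_union.1 hz with hz | hz <;> rw [Finset.mem_singleton.1 hz] <;> assumption)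
    omega
  have hx0 := hzero x (Y ∪ Z)ᶜ (by simp [hxY, hxZ]) (by simp [hsY, hsZ])
    (fun h => hsX (h ▸ hxX)) bYZ
  have hy0 := hzero v₂ (X ∪ Z)ᶜ (by simp [hv₂X, hv₂Z]) (by simp [hsX, hsZ]) hv₂s bXZ
  refine hone (X ∩ Y) ?_
  have hsplit : (X ∩ Y)ᶜ = ({x} ∪ {v₂}) ∪ (X ∪ Y)ᶜ := by
    ext z
    simp only [Finset.mem_compl, Finset.mem_inter, Finset.mem_union, Finset.mem_singleton]
    constructor
    · intro h
      by_cases hzX : z ∈ X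
      · have hzY : z ∉ Y := fun h' => h ⟨hzX, h'⟩
        exact Or.inl (Or.inl
          (Finset.card_le_one.1 cXY z (by simp [hzX, hzY]) x (by simp [hxX, hxY])))
      · by_cases hzY : z ∈ Y
        · exact Or.inl (Or.inr
            (Finset.card_le_one.1 cYX z (by simp [hzX, hzY]) v₂ (by simp [hv₂X, hv₂Y])))
        · tauto
    · rintro ((rfl | rfl) | h)
      · tauto
      · tauto
      · tauto
  rw [cutValue, hsplit, weightBetween_union_right, weightBetween_union_right, hx0, hy0, bXY]
  · rw [Finset.disjoint_singleton]
    rintro rfl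
    exact hv₂X hxX
  · rw [Finset.disjoint_left]
    intro z hz
    rcases Finset.mem_union.1 hz with hz | hz <;> rw [Finset.mem_singleton.1 hz] <;>
      simp [hxX, hv₂Y]

end SplittingPair

/-! ### Contraction of node sets -/

section Contraction

variable {N M : Type*} [Fintype N] [DecidableEq M]

/-- The preimage of a set of nodes under `f`. -/
def fiberSet (f : N → M) (X : Finset M) : Finset N := Finset.univ.filter fun x => f x ∈ X

theorem mem_fiberSet {f : N → M} {X : Finset M} {x : N} : x ∈ fiberSet f X ↔ f x ∈ X := by
  simp [fiberSet]

/-- The edge weights obtained by identifying nodes along `f`. -/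
def mapWeight (f : N → M) (w : N → N → ℕ) (a b : M) : ℕ :=
  weightBetween w (fiberSet f {a}) (fiberSet f {b})

theorem sum_fiberSet (f : N → M) (X : Finset M) (g : N → ℕ) :
    ∑ a ∈ X, ∑ x ∈ fiberSet f {a}, g x = ∑ x ∈ fiberSet f X, g x := by
  rw [← Finset.sum_fiberwise_of_maps_to (s := fiberSet f X) (t := X) (g := f)
    (fun x hx => mem_fiberSet.1 hx)]
  refine Finset.sum_congr rfl fun a ha => Finset.sum_congr ?_ fun _ _ => rfl
  ext x
  simp only [mem_fiberSet, Finset.mem_filter, Finset.mem_singleton]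
  exact ⟨fun h => ⟨h ▸ ha, h⟩, fun h => h.2⟩

theorem weightBetween_mapWeight (f : N → M) (w : N → N → ℕ) (A B : Finset M) :
    weightBetween (mapWeight f w) A B = weightBetween w (fiberSet f A) (fiberSet f B) := by
  have h : ∀ a, ∑ b ∈ B, mapWeight f w a b = ∑ x ∈ fiberSet f {a}, ∑ y ∈ fiberSet f B, w x y := by
    intro a
    simp only [mapWeight, weightBetween]
    rw [Finset.sum_comm]
    exact Finset.sum_congr rfl fun x _ => sum_fiberSet f B (w x)
  rw [weightBetween, Finset.sum_congr rfl fun a _ => h a, sum_fiberSet, weightBetween]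

/-- Weight inside a fiber lands on the diagonal, which no cut sees. -/
theorem cutValue_mapWeight [Fintype M] [DecidableEq N] (f : N → M) (w : N → N → ℕ) (X : Finset M) :
    cutValue (mapWeight f w) X = cutValue w (fiberSet f X) := by
  rw [cutValue, weightBetween_mapWeight, cutValue]
  congr 1
  ext x
  simp [mem_fiberSet]

/-- The requirement between two nodes of the contracted graph. -/
def mapReq (f : N → M) (r : N → N → ℕ) (a b : M) : ℕ :=
  (fiberSet f {a} ×ˢ fiberSet f {b}).sup fun p => r p.1 p.2

theorem mapReq_comm (f : N → M) {r : N → N → ℕ} (hr : ∀ x y, r x y = r y x) (a b : M) :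
    mapReq f r a b = mapReq f r b a := by
  have h : ∀ a b, mapReq f r a b ≤ mapReq f r b a := by
    intro a b
    refine Finset.sup_le fun p hp => ?_
    rw [hr]
    exact Finset.le_sup (f := fun p : N × N => r p.1 p.2) (b := (p.2, p.1))
      (by simpa [and_comm] using hp)
  exact le_antisymm (h a b) (h b a)

/-- Since `s` is alone in its fiber, excluding `f s` after contraction is the same as excluding `s`
before it. -/
theorem reqMax_mapReq [Fintype M] [DecidableEq N] {f : N → M} {s : N} (hf : ∀ x, f x = f s → x = s) (r : N → N → ℕ)
    (X : Finset M) : reqMax (f s) (mapReq f r) X = reqMax s r (fiberSet f X) := by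
  refine le_antisymm (reqMax_le fun a ha b hb hbs => Finset.sup_le fun p hp => ?_)
    (reqMax_le fun x hx y hy hys => ?_)
  · simp only [Finset.mem_product, mem_fiberSet, Finset.mem_singleton] at hp
    refine le_reqMax r (mem_fiberSet.2 (hp.1 ▸ ha)) (fun h => hb (hp.2 ▸ mem_fiberSet.1 h)) ?_
    rintro h
    exact hbs (by rw [← hp.2, h])
  · have h1 : r x y ≤ mapReq f r (f x) (f y) :=
      Finset.le_sup (f := fun p : N × N => r p.1 p.2) (b := (x, y)) (by simp [mem_fiberSet])
    exact h1.trans (le_reqMax _ (mem_fiberSet.1 hx) (fun h => hy (mem_fiberSet.2 h))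
      fun h => hys (hf y h))

theorem exists_pos_of_mapWeight_pos {f : N → M} {w : N → N → ℕ} {s : N}
    (hf : ∀ x, f x = f s → x = s) {a : M} (h : 0 < mapWeight f w (f s) a) :
    ∃ x, f x = a ∧ 0 < w s x := by
  have hs : fiberSet f {f s} = {s} := by
    ext x
    simp only [mem_fiberSet, Finset.mem_singleton]
    exact ⟨hf x, fun h => h ▸ rfl⟩
  rw [mapWeight, hs, weightBetween, Finset.sum_singleton] at h
  by_contra! hno
  refine h.ne' (Finset.sum_eq_zero fun x hx => ?_)
  exact Nat.le_zero.1 (hno x (by simpa [mem_fiberSet] using hx))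

/-- Lifts a pair of edges of the contracted graph. When both go to the same node, the two units of
weight come either from one parallel class or from two nodes of the fiber. -/
theorem exists_pair_of_mapWeight [DecidableEq N] {f : N → M} {w : N → N → ℕ} {s : N}
    (hf : ∀ x, f x = f s → x = s) {a b : M} (ha : 0 < mapWeight f w (f s) a)
    (hb : 0 < mapWeight f w (f s) b) (hab : a = b → 2 ≤ mapWeight f w (f s) a) :
    ∃ x y, f x = a ∧ f y = b ∧ 0 < w s x ∧ 0 < w s y ∧ (x = y → 2 ≤ w s x) := by
  obtain ⟨x, hx, hxw⟩ := exists_pos_of_mapWeight_pos hf ha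
  by_cases hne : a = b
  · subst hne
    by_cases h2 : 2 ≤ w s x
    · exact ⟨x, x, hx, hx, hxw, hxw, fun _ => h2⟩
    · have hs : fiberSet f {f s} = {s} := by
        ext z
        simp only [mem_fiberSet, Finset.mem_singleton]
        exact ⟨hf z, fun h => h ▸ rfl⟩
      have h := hab rfl
      rw [mapWeight, hs, weightBetween, Finset.sum_singleton,
        ← Finset.add_sum_erase _ _ (show x ∈ fiberSet f {a} by simpa [mem_fiberSet] using hx)] at h
      by_contra! hno
      have h0 : ∑ y ∈ (fiberSet f {a}).erase x, w s y = 0 := by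
        refine Finset.sum_eq_zero fun y hy => ?_
        simp only [Finset.mem_erase, mem_fiberSet, Finset.mem_singleton] at hy
        by_contra h0
        exact absurd (hno x y hx hy.2 hxw (by omega)).1.symm hy.1
      omega
  · obtain ⟨y, hy, hyw⟩ := exists_pos_of_mapWeight_pos hf hb
    exact ⟨x, y, hx, hy, hxw, hyw, fun h => absurd (by rw [← hx, ← hy, h]) hne⟩

end Contraction

/-! ### Mader's theorem in general -/

section SplittingLemma

universe u

/-- Uncrossing a set of small surplus with a tight set. -/
theorem exists_uncrossed {N : Type*} [Fintype N] [DecidableEq N] {w : N → N → ℕ}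
    (hw : ∀ x y, w x y = w y x) {s : N} (hpos : 2 ≤ cutValue w {s}) {T X : Finset N}
    (hsT : s ∉ T) (hT : T.Nonempty) (hTt : cutValue w T ≤ reqMax s (localConn w) T)
    (hsX : s ∉ X) (hX : cutValue w X ≤ reqMax s (localConn w) X + 1)
    {u v : N} (hu : u ∈ X) (hv : v ∈ X) (hsu : 0 < w s u) (hsv : 0 < w s v) :
    ∃ Y : Finset N, s ∉ Y ∧ (T ⊆ Y ∨ Disjoint T Y) ∧ u ∈ Y ∧ v ∈ Y ∧
      cutValue w Y ≤ reqMax s (localConn w) Y + 1 := by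
  set R := reqMax s (localConn w) with hR
  have hne : ∀ Z : Finset N, cutValue w Z ≤ R Z + 1 → Z ≠ {s}ᶜ := by
    rintro Z hZ rfl
    rw [hR, reqMax_compl_singleton, cutValue_compl hw] at hZ
    omega
  have hskew := reqMax_skew (localConn_comm hw) hsX hsT ⟨u, hu⟩ hT (hne X hX)
    (hne T (hTt.trans (Nat.le_succ _)))
  rw [← hR] at hskew
  rcases hskew with h | h
  · have h1 := cutValue_submodular hw X T
    have h2 : R (X ∩ T) ≤ _ := reqMax_localConn_le w s (X ∩ T)
    exact ⟨X ∪ T, by simp [hsX, hsT], Or.inl Finset.subset_union_right, by simp [hu],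
      by simp [hv], by omega⟩
  · have h1 := cutValue_posimodular hw X T
    have h2 : R (T \ X) ≤ _ := reqMax_localConn_le w s (T \ X)
    have h3 : R (X \ T) ≤ _ := reqMax_localConn_le w s (X \ T)
    -- An edge from `s` to `X ∩ T` would cost two units in the posimodular identity, and the joint
    -- surplus of `X` and `T` is at most one.
    have h4 : ∀ z ∈ X, 0 < w s z → z ∉ T := by
      intro z hz hzw hzT
      have h5 : w z s ≤ weightBetween w (X ∩ T) (X ∪ T)ᶜ :=
        le_weightBetween w (by simp [hz, hzT]) (by simp [hsX, hsT])
      rw [hw] at h5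
      omega
    exact ⟨X \ T, by simp [hsX], Or.inr Finset.disjoint_sdiff, by simp [hu, h4 u hu hsu],
      by simp [hv, h4 v hv hsv], by omega⟩

/-- Mader's splitting-off theorem at a node of even degree: if there is no cut of weight one and
the requirement `r` between the nodes other than `s` is met, then some two edges at `s` can be
split off without violating `r`. -/
theorem exists_splitting_pair (n : ℕ) : ∀ {N : Type u} [Fintype N] [DecidableEq N],
    Fintype.card N = n → ∀ {w : N → N → ℕ}, (∀ x y, w x y = w y x) → ∀ {s : N},
    Even (cutValue w {s}) → 0 < cutValue w {s} → (∀ A, cutValue w A ≠ 1) →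
    ∀ {r : N → N → ℕ}, (∀ x y, r x y = r y x) →
    (∀ X : Finset N, s ∉ X → reqMax s r X ≤ cutValue w X) →
    ∃ u v, u ≠ s ∧ v ≠ s ∧ 0 < w s u ∧ 0 < w s v ∧ (u = v → 2 ≤ w s u) ∧
      ∀ X : Finset N, s ∉ X → u ∈ X → v ∈ X → reqMax s r X + 2 ≤ cutValue w X := by
  induction n using Nat.strong_induction_on with
  | _ n ih =>
  intro N _ _ hn w hw s heven hpos hone r hr hreq
  have htwo : 2 ≤ cutValue w {s} := by rw [Nat.even_iff] at heven; omega
  have hle : ∀ X : Finset N, s ∉ X → reqMax s r X ≤ reqMax s (localConn w) X := by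
    intro X hsX
    refine reqMax_le fun x hx y hy hys => le_trans ?_ (le_reqMax _ hx hy hys)
    have hxs : x ≠ s := fun h => hsX (h ▸ hx)
    obtain ⟨W, hxW, hyW, hW⟩ := exists_localConn_eq w (show x ≠ y from fun h => hy (h ▸ hx))
    rw [← hW]
    by_cases hsW : s ∈ W
    · rw [hr, ← cutValue_compl hw]
      exact (le_reqMax r (by simpa using hyW) (by simpa using hxW) hxs).trans
        (hreq _ (by simpa using hsW))
    · exact (le_reqMax r hxW hyW hys).trans (hreq _ hsW)
  -- The local connectivity dominates every requirement that is met, so it is the strongest one to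
  -- preserve.
  suffices h : ∃ u v, u ≠ s ∧ v ≠ s ∧ 0 < w s u ∧ 0 < w s v ∧ (u = v → 2 ≤ w s u) ∧
      ∀ X : Finset N, s ∉ X → u ∈ X → v ∈ X →
        reqMax s (localConn w) X + 2 ≤ cutValue w X by
    obtain ⟨u, v, h1, h2, h3, h4, h5, h6⟩ := h
    exact ⟨u, v, h1, h2, h3, h4, h5, fun X hs hu hv =>
      (Nat.add_le_add_right (hle X hs) 2).trans (h6 X hs hu hv)⟩
  by_cases htight : ∀ T : Finset N, s ∉ T → cutValue w T ≤ reqMax s (localConn w) T → T.card ≤ 1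
  · exact exists_splitting_pair_of_tight_singletons hw heven hpos hone htight
  push Not at htight
  obtain ⟨T, hsT, hT, hcard⟩ := htight
  obtain ⟨t, ht, t', ht', htt'⟩ := Finset.one_lt_card.1 hcard
  -- `f` contracts the tight set `T` to its node `t`.
  let f : N → {x // x ∉ T ∨ x = t} := fun x =>
    if hx : x ∈ T then ⟨t, Or.inr rfl⟩ else ⟨x, Or.inl hx⟩
  have hfT : ∀ x ∈ T, f x = ⟨t, Or.inr rfl⟩ := fun x hx => by simp [f, hx]
  have hfN : ∀ x, ∀ hx : x ∉ T, f x = ⟨x, Or.inl hx⟩ := fun x hx => by simp [f, hx]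
  have hf : ∀ x, f x = f s → x = s := by
    intro x hx
    by_cases hxT : x ∈ T
    · rw [hfT x hxT, hfN s hsT, Subtype.mk.injEq] at hx
      exact absurd (hx ▸ ht) hsT
    · rwa [hfN x hxT, hfN s hsT, Subtype.mk.injEq] at hx
  have hsat : ∀ Y : Finset N, (T ⊆ Y ∨ Disjoint T Y) →
      fiberSet f (Finset.univ.filter fun a => (a : N) ∈ Y) = Y := by
    intro Y hY
    ext x
    rw [mem_fiberSet]
    simp only [Finset.mem_filter, Finset.mem_univ, true_and]
    by_cases hx : x ∈ T
    · rw [hfT x hx]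
      rcases hY with hY | hY
      · exact iff_of_true (hY ht) (hY hx)
      · exact iff_of_false (Finset.disjoint_left.1 hY ht) (Finset.disjoint_left.1 hY hx)
    · rw [hfN x hx]
  have hsingle : fiberSet f {f s} = {s} := by
    ext x
    simp only [mem_fiberSet, Finset.mem_singleton]
    exact ⟨hf x, fun h => h ▸ rfl⟩
  have hlt : Fintype.card {x // x ∉ T ∨ x = t} < n := by
    rw [← hn]
    exact Fintype.card_subtype_lt (x := t') (by simp [ht', htt'.symm])
  have hcs : cutValue (mapWeight f w) {f s} = cutValue w {s} := by
    rw [cutValue_mapWeight, hsingle]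
  -- The contracted graph inherits the old local connectivity as requirement, which need not be its
  -- own; this is why the induction runs over arbitrary `r`.
  obtain ⟨a, b, has, hbs, hwa, hwb, hab, hgood⟩ := ih _ hlt rfl (w := mapWeight f w)
    (fun _ _ => weightBetween_comm hw _ _) (s := f s) (by rwa [hcs]) (by rwa [hcs])
    (fun A => by rw [cutValue_mapWeight]; exact hone _) (r := mapReq f (localConn w))
    (mapReq_comm f (localConn_comm hw)) (fun X _ => by
      rw [cutValue_mapWeight, reqMax_mapReq hf]
      exact reqMax_localConn_le w s _)
  obtain ⟨u, v, hu, hv, hsu, hsv, huv⟩ := exists_pair_of_mapWeight hf hwa hwb hab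
  refine ⟨u, v, fun h => has (by rw [← hu, h]), fun h => hbs (by rw [← hv, h]), hsu, hsv, huv,
    fun X hsX huX hvX => ?_⟩
  by_contra hX
  -- A dangerous set obstructing the lifted pair may cross `T`; the uncrossed `Y` does not, so it is
  -- a set of the contracted graph and contradicts `hgood`.
  obtain ⟨Y, hsY, hTY, huY, hvY, hY⟩ := exists_uncrossed hw htwo hsT ⟨t, ht⟩ hT hsX (by omega)
    huX hvX hsu hsv
  have hsat := hsat Y hTY
  have h := hgood (Finset.univ.filter fun a => (a : N) ∈ Y)
    (by rwa [← mem_fiberSet, hsat]) (by rwa [← hu, ← mem_fiberSet, hsat])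
    (by rwa [← hv, ← mem_fiberSet, hsat])
  rw [cutValue_mapWeight, reqMax_mapReq hf, hsat] at h
  omega

end SplittingLemma

/-! ### Splitting off in multigraphs -/

section SplittingOff

variable {N : Type*} [DecidableEq N]

theorem exists_splitOff_eq {s u z : N} {m : Sym2 N → ℕ} (hu : 0 < m s(s, u))
    (hz : 0 < m s(s, z)) (huz : u = z → 2 ≤ m s(s, u)) :
    ∃ m' : Sym2 N → ℕ,
      m' + Pi.single s(s, u) 1 + Pi.single s(s, z) 1 = m + Pi.single s(u, z) 1 := by
  refine ⟨fun e => m e + (Pi.single s(u, z) 1 : Sym2 N → ℕ) e -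
    (Pi.single s(s, u) 1 : Sym2 N → ℕ) e - (Pi.single s(s, z) 1 : Sym2 N → ℕ) e, ?_⟩
  ext e
  simp only [Pi.add_apply]
  -- Both edges are present, twice if they are parallel, so the truncated subtractions are exact.
  have h : (Pi.single s(s, u) 1 : Sym2 N → ℕ) e + (Pi.single s(s, z) 1 : Sym2 N → ℕ) e ≤ m e := by
    simp only [Pi.single_apply]
    by_cases h1 : e = s(s, u) <;> by_cases h2 : e = s(s, z)
    · have := huz (Sym2.congr_right.1 (h1.symm.trans h2))
      subst h1
      simpa [← h2] using this
    · subst h1; simp [h2]; omega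
    · subst h2; simp [h1]; omega
    · simp [h1, h2]
  omega

variable [Fintype N]

/-- The number of edges of the multigraph `m` in the cut defined by `X`. -/
def multiCut (m : Sym2 N → ℕ) (X : Finset N) : ℕ := cutValue (fun x y => m s(x, y)) X

theorem multiCut_compl (m : Sym2 N → ℕ) (X : Finset N) : multiCut m Xᶜ = multiCut m X :=
  cutValue_compl (fun x y => by rw [Sym2.eq_swap]) X

theorem multiCut_add (m m' : Sym2 N → ℕ) (X : Finset N) :
    multiCut (m + m') X = multiCut m X + multiCut m' X := by
  simp [multiCut, cutValue, weightBetween, Finset.sum_add_distrib]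

theorem multiCut_single (a b : N) (X : Finset N) :
    multiCut (Pi.single s(a, b) 1) X =
      (if a ∈ X ∧ b ∉ X then 1 else 0) + (if b ∈ X ∧ a ∉ X then 1 else 0) := by
  have h : ∀ x ∈ X, ∀ y ∈ Xᶜ, (Pi.single s(a, b) 1 : Sym2 N → ℕ) s(x, y) =
      (if x = a then if y = b then 1 else 0 else 0) +
        (if x = b then if y = a then 1 else 0 else 0) := by
    intro x hx y hy
    have hxy : x ≠ y := fun h => (Finset.mem_compl.1 hy) (h ▸ hx)
    rw [Pi.single_apply]
    simp only [Sym2.eq_iff]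
    by_cases h1 : x = a <;> by_cases h2 : y = b <;> by_cases h3 : x = b <;>
      by_cases h4 : y = a <;> simp_all
  rw [multiCut, cutValue, weightBetween,
    Finset.sum_congr rfl fun x hx => Finset.sum_congr rfl fun y hy => h x hx y hy]
  simp [Finset.sum_add_distrib, Finset.sum_ite_eq', ite_and, Finset.sum_ite_irrel]

/-- `m` satisfies the requirement `q` between the nodes of `V`, and all nodes outside `V` have
even degree. -/
structure IsAdmissible (V : Finset N) (q : N → N → ℕ) (m : Sym2 N → ℕ) : Prop where
  even_degree : ∀ w ∉ V, Even (multiCut m {w})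
  req_le : ∀ X : Finset N, ∀ i ∈ V, ∀ j ∈ V, i ∈ X → j ∉ X → q i j ≤ multiCut m X

theorem IsAdmissible.multiCut_ne_one {V : Finset N} {q : N → N → ℕ} {m : Sym2 N → ℕ}
    (hm : IsAdmissible V q m) (hq : ∀ i ∈ V, ∀ j ∈ V, i ≠ j → 2 ≤ q i j) (X : Finset N) :
    multiCut m X ≠ 1 := by
  have hev : ∀ Y : Finset N, (∀ y ∈ Y, y ∉ V) → multiCut m Y ≠ 1 := by
    intro Y hY h1
    have h := even_cutValue (w := fun x y => m s(x, y)) (fun x y => by rw [Sym2.eq_swap]) Y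
      fun a ha => hm.even_degree a (hY a ha)
    change Even (multiCut m Y) at h
    rw [h1] at h
    exact absurd h (by decide)
  by_cases h1 : ∀ x ∈ X, x ∉ V
  · exact hev X h1
  by_cases h2 : ∀ x ∈ Xᶜ, x ∉ V
  · rw [← multiCut_compl]
    exact hev Xᶜ h2
  push Not at h1 h2
  obtain ⟨i, hiX, hi⟩ := h1
  obtain ⟨j, hjX, hj⟩ := h2
  rw [Finset.mem_compl] at hjX
  have h3 := hm.req_le X i hi j hj hiX hjX
  have h4 := hq i hi j hj fun h => hjX (h ▸ hiX)
  omega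

theorem SplitOff.multiCut_add {s u z : N} {m m' : Sym2 N → ℕ}
    (h : m' + Pi.single s(s, u) 1 + Pi.single s(s, z) 1 = m + Pi.single s(u, z) 1)
    (X : Finset N) :
    multiCut m' X + multiCut (Pi.single s(s, u) 1) X + multiCut (Pi.single s(s, z) 1) X =
      multiCut m X + multiCut (Pi.single s(u, z) 1) X := by
  rw [← NetSynth.multiCut_add, ← NetSynth.multiCut_add, h, NetSynth.multiCut_add]

theorem IsAdmissible.exists_splitOff {V : Finset N} {q : N → N → ℕ} {m : Sym2 N → ℕ}
    (hm : IsAdmissible V q m) (hqs : ∀ i j, q i j = q j i)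
    (hq : ∀ i ∈ V, ∀ j ∈ V, i ≠ j → 2 ≤ q i j) {s : N} (hs : s ∉ V) (hpos : 0 < multiCut m {s}) :
    ∃ m' : Sym2 N → ℕ, SplitOff s m m' ∧ IsAdmissible V q m' ∧
      (∀ X, multiCut m' X ≤ multiCut m X) ∧ ∑ e, m' e < ∑ e, m e := by
  obtain ⟨u, z, hus, hzs, hu, hz, huz, hgood⟩ := exists_splitting_pair _ (N := N) rfl
    (w := fun x y => m s(x, y)) (fun x y => by rw [Sym2.eq_swap]) (s := s)
    (hm.even_degree s hs) hpos (hm.multiCut_ne_one hq)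
    (r := fun i j => if i ∈ V ∧ j ∈ V then q i j else 0)
    (fun i j => by simp only [hqs i j, and_comm]) (fun X _ => reqMax_le fun i hi j hj _ => by
      split_ifs with h
      · exact hm.req_le X i h.1 j h.2 hi hj
      · exact Nat.zero_le _)
  obtain ⟨m', hm'⟩ := exists_splitOff_eq hu hz huz
  have hcut := SplitOff.multiCut_add hm'
  simp only [multiCut_single] at hcut
  -- For `s ∉ X` the cut changes only if `u` and `z` both lie in `X`; it then loses two, which
  -- `hgood` allows.
  have hreq : ∀ X : Finset N, s ∉ X → ∀ i ∈ V, ∀ j ∈ V, i ∈ X → j ∉ X → q i j ≤ multiCut m' X := by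
    intro X hsX i hi j hj hiX hjX
    have h1 := hm.req_le X i hi j hj hiX hjX
    have h2 := hcut X
    by_cases huX : u ∈ X <;> by_cases hzX : z ∈ X <;> simp [hsX, huX, hzX] at h2
    · have h3 := hgood X hsX huX hzX
      have h4 := le_reqMax (s := s) (fun i j => if i ∈ V ∧ j ∈ V then q i j else 0) hiX hjX
        fun h => hs (h ▸ hj)
      simp only [hi, hj, and_self, if_true] at h4
      change _ ≤ multiCut m X at h3
      omega
    all_goals omega
  refine ⟨m', ⟨u, z, hus, hzs, hm'⟩, ⟨fun w hw => ?_, fun X i hi j hj hiX hjX => ?_⟩,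
    fun X => ?_, ?_⟩
  · have h1 := hm.even_degree w hw
    have h2 := hcut {w}
    rw [Nat.even_iff] at *
    simp only [Finset.mem_singleton] at h2
    split_ifs at h2 <;> first | omega | (exfalso; aesop)
  · by_cases hsX : s ∈ X
    · rw [hqs, ← multiCut_compl]
      exact hreq Xᶜ (by simpa using hsX) j hj i hi (by simpa using hjX) (by simpa using hiX)
    · exact hreq X hsX i hi j hj hiX hjX
  · have h2 := hcut X
    by_cases hsX : s ∈ X <;> by_cases huX : u ∈ X <;> by_cases hzX : z ∈ X <;>
      simp [hsX, huX, hzX] at h2 <;> omega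
  · have h := congrArg (fun g : Sym2 N → ℕ => ∑ e, g e) hm'
    simp only [Pi.add_apply, Finset.sum_add_distrib, Finset.sum_pi_single', Finset.mem_univ,
      if_true] at h
    omega

theorem IsAdmissible.exists_splitsTo {V : Finset N} {q : N → N → ℕ}
    (hqs : ∀ i j, q i j = q j i) (hq : ∀ i ∈ V, ∀ j ∈ V, i ≠ j → 2 ≤ q i j) (n : ℕ) :
    ∀ m : Sym2 N → ℕ, ∑ e, m e = n → IsAdmissible V q m →
      ∃ m' : Sym2 N → ℕ, SplitsTo V m m' ∧ IsAdmissible V q m' ∧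
        (∀ X, multiCut m' X ≤ multiCut m X) ∧ ∀ s ∉ V, multiCut m' {s} = 0 := by
  induction n using Nat.strong_induction_on with
  | _ n ih =>
  intro m hn hm
  by_cases hdone : ∀ s ∉ V, multiCut m {s} = 0
  · exact ⟨m, Relation.ReflTransGen.refl, hm, fun _ => le_rfl, hdone⟩
  push Not at hdone
  obtain ⟨s, hs, hpos⟩ := hdone
  obtain ⟨m₁, hsplit, hm₁, hle, hlt⟩ := hm.exists_splitOff hqs hq hs (Nat.pos_of_ne_zero hpos)
  obtain ⟨m', hto, hm', hle', hdone⟩ := ih _ (hn ▸ hlt) m₁ rfl hm₁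
  exact ⟨m', Relation.ReflTransGen.head ⟨s, hs, hsplit⟩ hto, hm',
    fun X => (hle' X).trans (hle X), hdone⟩

/-- Stated for any graph because it serves both `T` and the complete graph on `V`. -/
theorem multiCut_treeMultigraph (G : SimpleGraph N) [DecidableRel G.Adj] [Fintype G.edgeSet]
    (c : G.edgeSet → ℕ) (X : Finset N) :
    multiCut (treeMultigraph G c) X = ∑ e ∈ cut G X, c e := by
  rw [multiCut, cutValue, weightBetween, ← Finset.sum_product',
    ← Finset.sum_filter_of_ne (p := fun p : N × N => G.Adj p.1 p.2)]
  · refine Finset.sum_bij (fun p hp => ⟨s(p.1, p.2), (Finset.mem_filter.1 hp).2⟩) ?_ ?_ ?_ ?_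
    · intro p hp
      simp only [Finset.mem_filter, Finset.mem_product, Finset.mem_compl] at hp
      simp only [cut, Finset.mem_filter, Finset.mem_univ, true_and]
      exact ⟨p.1, hp.1.1, p.2, hp.1.2, rfl⟩
    · intro p hp p' hp' h
      simp only [Finset.mem_filter, Finset.mem_product, Finset.mem_compl] at hp hp'
      replace h := Sym2.eq_iff.1 (Subtype.ext_iff.1 h)
      rcases h with h | h
      · exact Prod.ext h.1 h.2
      · exact absurd (h.1 ▸ hp.1.1) hp'.1.2
    · rintro ⟨e, he⟩ hcut
      simp only [cut, Finset.mem_filter, Finset.mem_univ, true_and] at hcut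
      obtain ⟨i, hi, j, hj, rfl⟩ := hcut
      exact ⟨(i, j), by simpa [hi, hj] using he, rfl⟩
    · intro p hp
      exact dif_pos (Finset.mem_filter.1 hp).2
  · intro p _ hne
    by_contra h
    exact hne (dif_neg h)

end SplittingOff

/-! ### Fundamental cuts and paths of the tree -/

section TreeCuts

variable {N : Type*} {T : SimpleGraph N}

theorem mem_edges_iff_not_reachable (hT : T.IsTree) {i j : N} (p : T.Path i j) (e : Sym2 N) :
    e ∈ (p : T.Walk i j).edges ↔ ¬ (T.deleteEdges {e}).Reachable i j := by
  constructor
  · intro he hreach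
    obtain ⟨q, hq⟩ := hreach.exists_isPath
    have hle := T.deleteEdges_le {e}
    have h := (hT.isAcyclic.subsingleton_path i j).elim p ⟨q.mapLe hle, hq.mapLe hle⟩
    rw [h] at he
    have he' : e ∈ q.edges := by simpa using he
    simpa using q.edges_subset_edgeSet he'
  · intro h
    by_contra he
    exact h ⟨(p : T.Walk i j).toDeleteEdges {e} fun e' he' h' => he (h' ▸ he')⟩

theorem reachable_deleteEdges_or (hT : T.Connected) (a b x : N) :
    (T.deleteEdges {s(a, b)}).Reachable x a ∨ (T.deleteEdges {s(a, b)}).Reachable x b := by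
  by_contra hx
  obtain ⟨p⟩ := hT.preconnected a x
  obtain ⟨d, -, hd1, hd2⟩ := p.exists_boundary_dart
    {x | (T.deleteEdges {s(a, b)}).Reachable x a ∨ (T.deleteEdges {s(a, b)}).Reachable x b}
    (Or.inl (SimpleGraph.Reachable.refl _)) hx
  apply hd2
  by_cases hd : s(d.fst, d.snd) = s(a, b)
  · rcases Sym2.eq_iff.1 hd with ⟨-, h⟩ | ⟨-, h⟩
    · exact Or.inr (h ▸ SimpleGraph.Reachable.refl _)
    · exact Or.inl (h ▸ SimpleGraph.Reachable.refl _)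
  · have hadj : (T.deleteEdges {s(a, b)}).Adj d.snd d.fst :=
      SimpleGraph.Adj.symm (by simpa [SimpleGraph.deleteEdges_adj, d.adj] using hd)
    exact hd1.imp hadj.reachable.trans hadj.reachable.trans

/-- Deleting one edge leaves at most two components, so nodes not reachable from `v` are reachable
from each other. -/
theorem not_reachable_deleteEdges_iff (hT : T.Connected) (e : Sym2 N) (v i j : N) :
    ¬ (T.deleteEdges {e}).Reachable i j ↔
      ¬ ((T.deleteEdges {e}).Reachable v i ↔ (T.deleteEdges {e}).Reachable v j) := by
  induction e using Sym2.ind with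
  | _ a b =>
  rw [not_iff_not]
  constructor
  · exact fun h => ⟨fun h' => h'.trans h, fun h' => h'.trans h.symm⟩
  · intro h
    by_cases hi : (T.deleteEdges {s(a, b)}).Reachable v i
    · exact hi.symm.trans (h.1 hi)
    · have hj : ¬ (T.deleteEdges {s(a, b)}).Reachable v j := fun h' => hi (h.2 h')
      rcases reachable_deleteEdges_or hT a b v with hv | hv <;>
        rcases reachable_deleteEdges_or hT a b i with hia | hib <;>
        rcases reachable_deleteEdges_or hT a b j with hja | hjb
      all_goals first
        | exact absurd (hv.trans hia.symm) hi
        | exact absurd (hv.trans hib.symm) hi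
        | exact absurd (hv.trans hja.symm) hj
        | exact absurd (hv.trans hjb.symm) hj
        | exact hia.trans hja.symm
        | exact hib.trans hjb.symm

theorem mk_mem_cut {α : Type*} {G : SimpleGraph α} [Fintype G.edgeSet] {X : Finset α} {i j : α}
    (h : s(i, j) ∈ G.edgeSet) :
    (⟨s(i, j), h⟩ : G.edgeSet) ∈ cut G X ↔ (i ∈ X ∧ j ∉ X) ∨ (j ∈ X ∧ i ∉ X) := by
  simp only [cut, Finset.mem_filter, Finset.mem_univ, true_and]
  constructor
  · rintro ⟨a, ha, b, hb, hab⟩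
    rcases Sym2.eq_iff.1 hab with ⟨rfl, rfl⟩ | ⟨rfl, rfl⟩
    · exact Or.inl ⟨ha, hb⟩
    · exact Or.inr ⟨ha, hb⟩
  · rintro (⟨hi, hj⟩ | ⟨hj, hi⟩)
    · exact ⟨i, hi, j, hj, rfl⟩
    · exact ⟨j, hj, i, hi, Sym2.eq_swap⟩

theorem mem_cut_singleton {G : SimpleGraph N} [Fintype G.edgeSet] {w : N} {e : G.edgeSet} :
    e ∈ cut G {w} ↔ w ∈ (e : Sym2 N) := by
  obtain ⟨e, he⟩ := e
  induction e using Sym2.ind with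
  | _ a b =>
  have hab : a ≠ b := G.ne_of_adj he
  rw [mk_mem_cut]
  simp only [Finset.mem_singleton, Sym2.mem_iff]
  constructor
  · rintro (h | h)
    · exact Or.inl h.1.symm
    · exact Or.inr h.1.symm
  · rintro (rfl | rfl)
    · exact Or.inl ⟨rfl, hab.symm⟩
    · exact Or.inr ⟨rfl, hab⟩

theorem exists_path (hT : T.IsTree) (i j : N) : Nonempty (T.Path i j) := by
  obtain ⟨p, hp⟩ := (hT.connected.preconnected i j).exists_isPath
  exact ⟨⟨p, hp⟩⟩

variable {V : Finset N} [Fintype N] [DecidableEq N]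

theorem mem_side (v : V) (e : T.edgeSet) (u : V) :
    u ∈ side T v e ↔ (T.deleteEdges {(e : Sym2 N)}).Reachable (v : N) (u : N) := by
  simp [side]

theorem mk_mem_cut_side_iff (hT : T.IsTree) (v : V) (e : T.edgeSet) {i j : V} (h : i ≠ j)
    (p : T.Path (i : N) (j : N)) :
    (⟨s(i, j), h⟩ : CompleteEdge V) ∈ cut (⊤ : SimpleGraph V) (side T v e) ↔
      (e : Sym2 N) ∈ (p : T.Walk (i : N) (j : N)).edges := by
  rw [mem_edges_iff_not_reachable hT, not_reachable_deleteEdges_iff hT.connected _ v]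
  refine (mk_mem_cut (G := ⊤) h).trans ?_
  rw [mem_side, mem_side]
  tauto

variable [DecidableRel T.Adj]

/-- The edges of a path at a node that is not an end of it are even in number. -/
theorem even_card_cut_filter (hT : T.IsTree) (v : V) {w : N} (hw : w ∉ V) (f : CompleteEdge V)
    [DecidablePred fun e : T.edgeSet => f ∈ cut (⊤ : SimpleGraph V) (side T v e)] :
    Even ((cut T {w}).filter fun e => f ∈ cut (⊤ : SimpleGraph V) (side T v e)).card := by
  obtain ⟨f, hf⟩ := f
  induction f using Sym2.ind with
  | _ i j =>
  obtain ⟨p⟩ := exists_path hT (i : N) (j : N)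
  have h := (p.2.isTrail.even_countP_edges_iff w).2 fun _ =>
    ⟨fun h => hw (h ▸ i.2), fun h => hw (h ▸ j.2)⟩
  convert h using 1
  rw [List.countP_eq_length_filter, ← List.toFinset_card_of_nodup
    (List.Nodup.filter _ p.2.isTrail.edges_nodup),
    ← Finset.card_image_of_injective _ Subtype.val_injective]
  congr 1
  ext e
  simp only [Finset.mem_image, Finset.mem_filter, List.mem_toFinset, List.mem_filter,
    decide_eq_true_eq]
  constructor
  · rintro ⟨e, ⟨h1, h2⟩, rfl⟩
    exact ⟨(mk_mem_cut_side_iff hT v e hf p).1 h2, mem_cut_singleton.1 h1⟩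
  · rintro ⟨h1, h2⟩
    let e' : T.edgeSet := ⟨e, (p : T.Walk (i : N) (j : N)).edges_subset_edgeSet h1⟩
    exact ⟨e', ⟨mem_cut_singleton.2 h2, (mk_mem_cut_side_iff hT v e' hf p).2 h1⟩, rfl⟩

/-- Double counting: the pair `ij` contributes to the capacity of `e` exactly when `e` lies on the
path from `i` to `j`. -/
theorem sum_length_mul_treeCapacity {l : T.edgeSet → ℝ≥0} {a : CompleteEdge V → ℝ≥0}
    (ha : IsRepresentedBy a T l) (v : V) (y : CompleteEdge V → ℕ) :
    ∑ e : T.edgeSet, l e * (treeCapacity T v y e : ℝ≥0) =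
      ∑ f : CompleteEdge V, a f * (y f : ℝ≥0) := by
  classical
  have hcap : ∀ e : T.edgeSet, l e * (treeCapacity T v y e : ℝ≥0) =
      ∑ f : CompleteEdge V,
        if f ∈ cut (⊤ : SimpleGraph V) (side T v e) then l e * (y f : ℝ≥0) else 0 := by
    intro e
    rw [treeCapacity, Nat.cast_sum, Finset.mul_sum, ← Finset.sum_filter, Finset.filter_mem_eq_inter,
      Finset.univ_inter]
  rw [Finset.sum_congr rfl fun e _ => hcap e, Finset.sum_comm]
  refine Finset.sum_congr rfl fun f _ => ?_
  rw [← Finset.sum_filter, ← Finset.sum_mul]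
  congr 1
  obtain ⟨f, hf⟩ := f
  induction f using Sym2.ind with
  | _ i j =>
  obtain ⟨p⟩ := exists_path ha.1 (i : N) (j : N)
  rw [ha.2 i j hf p, pathLength]
  refine Finset.sum_congr ?_ fun _ _ => rfl
  ext e
  simp only [Finset.mem_filter, Finset.mem_univ, true_and]
  exact mk_mem_cut_side_iff ha.1 v e hf p

theorem isFeasible_treeCapacity (hT : T.IsTree) {r : V → V → ℕ} (v : V)
    {y : CompleteEdge V → ℕ} (hy : IsIntegralRealization r y) :
    IsFeasible r T v (treeCapacity T v y) where
  even_degree w hw := by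
    classical
    have h : ∑ e ∈ cut T {w}, treeCapacity T v y e = ∑ f : CompleteEdge V,
        ((cut T {w}).filter fun e => f ∈ cut (⊤ : SimpleGraph V) (side T v e)).card * y f := by
      have hcap : ∀ e : T.edgeSet, treeCapacity T v y e = ∑ f : CompleteEdge V,
          if f ∈ cut (⊤ : SimpleGraph V) (side T v e) then y f else 0 := by
        intro e
        rw [treeCapacity, ← Finset.sum_filter, Finset.filter_mem_eq_inter, Finset.univ_inter]
      rw [Finset.sum_congr rfl fun e _ => hcap e, Finset.sum_comm]
      refine Finset.sum_congr rfl fun f _ => ?_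
      rw [← Finset.sum_filter, Finset.sum_const, smul_eq_mul]
    rw [h]
    exact Finset.even_sum _ fun f _ => (even_card_cut_filter hT v hw f).mul_right _
  req_le e := by
    refine Finset.sup_le fun p hp => ?_
    rw [Finset.mem_product, Finset.mem_compl] at hp
    have h := hy p.1 p.2 (fun h => hp.2 (h ▸ hp.1)) _ hp.1 hp.2
    rw [← Nat.cast_sum] at h
    exact Nat.cast_le.1 h

/-- The side of the tree edge `e` containing `v` is left by `e` only. -/
theorem multiCut_treeMultigraph_side_le (c : T.edgeSet → ℕ) (v : N) (e : T.edgeSet)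
    {X : Finset N} (hX : ∀ x, x ∈ X ↔ (T.deleteEdges {(e : Sym2 N)}).Reachable v x) :
    multiCut (treeMultigraph T c) X ≤ c e := by
  rw [multiCut_treeMultigraph, ← Finset.sum_singleton c e]
  refine Finset.sum_le_sum_of_subset fun e' he' => ?_
  rw [Finset.mem_singleton]
  by_contra hne
  simp only [cut, Finset.mem_filter, Finset.mem_univ, true_and] at he'
  obtain ⟨i, hi, j, hj, he'⟩ := he'
  have hadj : (T.deleteEdges {(e : Sym2 N)}).Adj i j := by
    rw [SimpleGraph.deleteEdges_adj, ← SimpleGraph.mem_edgeSet, ← he']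
    exact ⟨e'.2, fun h => hne (Subtype.ext h)⟩
  exact hj ((hX j).2 (((hX i).1 hi).trans hadj.reachable))

/-- The tree path from `i` to `j` leaves `X` along some edge `e`, whose fundamental cut separates
`i` and `j`. The bound `2`, from `R(X_e) > 1`, holds even where `r i j` is smaller and rules out
cuts of weight one. -/
theorem IsFeasible.le_multiCut (hT : T.IsTree) {r : V → V → ℕ} (hr : ∀ i j, r i j = r j i)
    {v : V} {c : T.edgeSet → ℕ} (hc : IsFeasible r T v c)
    (hR : ∀ e : T.edgeSet, 1 < maxReq r (side T v e)) {X : Finset N} {i j : V}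
    (hi : (i : N) ∈ X) (hj : (j : N) ∉ X) :
    max (r i j) 2 ≤ multiCut (treeMultigraph T c) X := by
  obtain ⟨p⟩ := exists_path hT (i : N) (j : N)
  have hij : i ≠ j := fun h => hj (h ▸ hi)
  obtain ⟨d, hd, hd1, hd2⟩ := (p : T.Walk (i : N) (j : N)).exists_boundary_dart (X : Set N) hi hj
  let e : T.edgeSet := ⟨s(d.fst, d.snd), d.adj⟩
  have hep : (e : Sym2 N) ∈ (p : T.Walk (i : N) (j : N)).edges := List.mem_map_of_mem hd
  have hcut := (mk_mem_cut (G := ⊤) hij).1 ((mk_mem_cut_side_iff hT v e hij p).2 hep)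
  have hreq : r i j ≤ maxReq r (side T v e) := by
    rcases hcut with h | h
    · exact Finset.le_sup (f := fun p : V × V => r p.1 p.2) (b := (i, j)) (by simp [h])
    · rw [hr]
      exact Finset.le_sup (f := fun p : V × V => r p.1 p.2) (b := (j, i)) (by simp [h])
  have hce : c e ≤ multiCut (treeMultigraph T c) X := by
    rw [multiCut_treeMultigraph]
    exact Finset.single_le_sum (f := c) (fun _ _ => Nat.zero_le _)
      ((mk_mem_cut (G := T) d.adj).2 (Or.inl ⟨by simpa using hd1, by simpa using hd2⟩))
  have h1 := hc.req_le e
  have h2 := hR e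
  exact max_le (hreq.trans (h1.trans hce)) (by omega)

end TreeCuts

/-! ### Restriction to the terminals -/

section Restriction

variable {N : Type*} [Fintype N] [DecidableEq N] {V : Finset N}

/-- If no edge of `m` leaves a node outside `V`, the cuts of `m` are those of its restriction
to `V`. -/
theorem sum_cut_restrict {m : Sym2 N → ℕ} (hm : ∀ s u : N, s ∉ V → u ≠ s → m s(s, u) = 0)
    (X : Finset N) (Y : Finset V) (hXY : ∀ u : V, (u : N) ∈ X ↔ u ∈ Y) :
    ∑ f ∈ cut (⊤ : SimpleGraph V) Y, m ((f : Sym2 V).map Subtype.val) = multiCut m X := by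
  have h1 := multiCut_treeMultigraph (⊤ : SimpleGraph V)
    (fun f => m ((f : Sym2 V).map Subtype.val)) Y
  rw [← h1]
  have hsum : ∀ (Z : Finset N) (W : Finset V), (∀ u : V, (u : N) ∈ Z ↔ u ∈ W) → ∀ g : N → ℕ,
      (∀ z ∈ Z, z ∉ V → g z = 0) → ∑ u ∈ W, g u = ∑ z ∈ Z, g z := by
    intro Z W hZW g hg
    refine Finset.sum_bij_ne_zero (fun u _ _ => (u : N)) (fun u hu _ => (hZW u).2 hu)
      (fun _ _ _ _ _ _ h => Subtype.ext h) (fun z hz hne => ?_) fun _ _ _ => rfl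
    have hzV : z ∈ V := by
      by_contra h
      exact hne (hg z hz h)
    exact ⟨⟨z, hzV⟩, (hZW ⟨z, hzV⟩).1 hz, hne, rfl⟩
  simp only [multiCut, cutValue, weightBetween]
  rw [← hsum X Y hXY fun x => ∑ y ∈ Xᶜ, m s(x, y)]
  · refine Finset.sum_congr rfl fun x hx => ?_
    rw [← hsum Xᶜ Yᶜ (fun u => by simp [hXY u]) fun y => m s((x : N), y)]
    · refine Finset.sum_congr rfl fun y hy => ?_
      have hxy : x ≠ y := fun h => Finset.mem_compl.1 hy (h ▸ hx)
      simp [treeMultigraph, hxy]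
    · intro z hz hzV
      rw [Sym2.eq_swap]
      exact hm z x hzV fun h => hzV (h ▸ x.2)
  · intro z hz hzV
    exact Finset.sum_eq_zero fun y hy =>
      hm z y hzV fun h => Finset.mem_compl.1 hy (h ▸ hz)

end Restriction

end NetSynth

/-! ### The theorem -/

open NetSynth
theorem theorem3p1 {N : Type*} [Fintype N] [DecidableEq N] (V : Finset N)
    (r : V → V → ℕ) (hr : ∀ i j : V, r i j = r j i)
    (T : SimpleGraph N) [DecidableRel T.Adj] (l : T.edgeSet → ℝ≥0)
    (a : CompleteEdge V → ℝ≥0) (ha : IsRepresentedBy a T l) (v : V)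
    (hR : ∀ e : T.edgeSet, 1 < maxReq r (side T v e)) :
    (∀ y : CompleteEdge V → ℕ, IsIntegralRealization r y →
      IsFeasible r T v (treeCapacity T v y) ∧
        ∑ e : T.edgeSet, l e * (treeCapacity T v y e : ℝ≥0) =
          ∑ e : CompleteEdge V, a e * (y e : ℝ≥0)) ∧
    (∀ c : T.edgeSet → ℕ, IsFeasible r T v c →
      ∃ y : CompleteEdge V → ℕ, IsIntegralRealization r y ∧
        ∑ e : CompleteEdge V, a e * (y e : ℝ≥0) ≤ ∑ e : T.edgeSet, l e * (c e : ℝ≥0) ∧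
        IsObtainedBySplitting T c y) := by
  refine ⟨fun y hy => ⟨isFeasible_treeCapacity ha.1 v hy, sum_length_mul_treeCapacity ha v y⟩,
    fun c hc => ?_⟩
  let q : N → N → ℕ := fun i j =>
    if h : i ∈ V ∧ j ∈ V then max (r ⟨i, h.1⟩ ⟨j, h.2⟩) 2 else 0
  have hq : ∀ i j : V, q i j = max (r i j) 2 := fun i j => dif_pos ⟨i.2, j.2⟩
  have hqs : ∀ i j, q i j = q j i := by
    intro i j
    by_cases h : i ∈ V ∧ j ∈ V
    · rw [hq ⟨i, h.1⟩ ⟨j, h.2⟩, hq ⟨j, h.2⟩ ⟨i, h.1⟩, hr]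
    · simp only [q, dif_neg h, dif_neg fun h' : j ∈ V ∧ i ∈ V => h h'.symm]
  have hadm : IsAdmissible V q (treeMultigraph T c) := by
    refine ⟨fun w hw => ?_, fun X i hi j hj hiX hjX => ?_⟩
    · rw [multiCut_treeMultigraph]
      exact hc.even_degree w hw
    · rw [hq ⟨i, hi⟩ ⟨j, hj⟩]
      exact hc.le_multiCut ha.1 hr hR (i := ⟨i, hi⟩) (j := ⟨j, hj⟩) hiX hjX
  obtain ⟨m, hsplit, hm, hle, hdone⟩ := IsAdmissible.exists_splitsTo hqs
    (fun i hi j hj _ => (le_max_right _ _).trans_eq (hq ⟨i, hi⟩ ⟨j, hj⟩).symm) _ _ rfl hadm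
  have hiso : ∀ s u : N, s ∉ V → u ≠ s → m s(s, u) = 0 := by
    intro s u hs hus
    refine Nat.le_zero.1 ((hdone s hs).symm ▸ ?_)
    exact le_weightBetween (fun x y => m s(x, y)) (Finset.mem_singleton_self s)
      (Finset.mem_compl.2 fun h => hus (Finset.mem_singleton.1 h))
  refine ⟨fun f => m ((f : Sym2 V).map Subtype.val), ?_, ?_, m, hsplit, hiso, fun _ => rfl⟩
  · intro s t _ X hs ht
    have h := hm.req_le (X.map (Function.Embedding.subtype _)) s s.2 t t.2 (by simpa using hs)
      (by simpa using ht)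
    rw [hq, ← sum_cut_restrict hiso _ X fun u => by simp] at h
    rw [← Nat.cast_sum]
    exact Nat.cast_le.2 ((le_max_left _ _).trans h)
  -- The cost of `y` is that of its tree loads. The load of `e` is a cut of `m`, at most the same
  -- cut of the initial multigraph, where only copies of `e` cross.
  · rw [← sum_length_mul_treeCapacity ha v]
    refine Finset.sum_le_sum fun e _ => mul_le_mul_right ?_ _
    classical
    rw [treeCapacity, sum_cut_restrict hiso
      (Finset.univ.filter fun x => (T.deleteEdges {(e : Sym2 N)}).Reachable (v : N) x) _
      fun u => by rw [mem_side]; simp]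
    exact_mod_cast (hle _).trans (multiCut_treeMultigraph_side_le c v e fun x => by simp)
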